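/- All languages are relational, and a structure in a language containing the binary symbol $<$ is called ordered if $<$ is interpreted as a strict linear order. The age of a structure $A$ is the class of all finite structures that embed in $A$. A class $\mathcal K$ of finite structures has the Ramsey property (RP) if for all $A,B\in\mathcal K$ and every integer $k\ge 1$ there is $C\in\mathcal K$ such that for every map $c:\binom{C}{A}\to\{1,\dots,k\}$ there is $B'\in\binom{C}{B}$ such that $c$ is constant on $\binom{B'}{A}$; here $\binom{Y}{X}$ is the set of substructures of $Y$ isomorphic to $X$. A structure has RP if its age has RP. Let $L_1,L_2$ be relational languages with $L_1\cap L_2=\{<\}$. Let $\mathcal I$ be a countable ordered $L_2$-structure with underlying set $I$, and for each $i\in I$ let $M_i$ be a countable ordered $L_1$-structure. Assume that there is a class $\mathcal K$ such that $\mathrm{age}(M_i)=\mathcal K$ for all $i\in I$. Let $\mathbb I=\mathcal I_{i\in I}(M_i)$ be the structure in the language $L_1\cup L_2\cup\{E\}$, where $E$ is a new binary relation symbol, whose domain is the disjoint union $\bigsqcup_{i\in I}M_i$ and whose relations are as follows. - $E^{\mathbb I}$ is the equivalence relation whose classes are the sets $M_i$. - For $a\in M_i$ and $b\in M_j$: $a<^{\mathbb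 I}b$ if and only if $i<^{\mathcal I}j$, or $i=j$ and $a<^{M_i}b$. - For $R\in L_1\setminus\{<\}$ of arity $n$: $R^{\mathbb I}(a_0,\dots,a_{n-1})$ if and only if there is $i\in I$ such that $a_0,\dots,a_{n-1}\in M_i$ and $M_i\models R(a_0,\dots,a_{n-1})$. - For $R\in L_2\setminus\{<\}$ of arity $n$ and $a_j\in M_{t_j}$ ($j<n$): $R^{\mathbb I}(a_0,\dots,a_{n-1})$ if and only if $\mathcal I\models R(t_0,\dots,t_{n-1})$. If $\mathcal I$ has RP and $\mathcal K$ has RP, then $\mathbb I$ has RP. -/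

import Mathlib

open scoped FirstOrder

universe u₁ u₂ v w

/-- The symbols of the relational language `{<} ∪ σ`; `σ n` is the set of `n`-ary
relation symbols other than `<`. -/
inductive OrdRel (σ : ℕ → Type v) : ℕ → Type v
  | lt : OrdRel σ 2
  | rel {n : ℕ} (R : σ n) : OrdRel σ n

/-- The relational language `{<} ∪ σ`. -/
def ordLanguage (σ : ℕ → Type v) : FirstOrder.Language.{0, v} where
  Functions := fun _ => Empty
  Relations := OrdRel σ

/-- `M` is an ordered structure: the symbol `<` is interpreted as a strict linear order. -/
def IsOrderedStructure (σ : ℕ → Type v) (M : Type w) [(ordLanguage σ).Structure M] : Prop :=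
  IsStrictTotalOrder M fun a b =>
    FirstOrder.Language.Structure.RelMap (L := ordLanguage σ) (OrdRel.lt : OrdRel σ 2) ![a, b]

/-- The set of copies of `A` in `C`: the substructures of `C` isomorphic to `A`. -/
def copies (L : FirstOrder.Language.{u₁, v}) (C A : Type w) [L.Structure C] [L.Structure A] :
    Set (L.Substructure C) :=
  {S | Nonempty (S ≃[L] A)}

/-- The Ramsey property of a class of structures. -/
def RamseyProperty {L : FirstOrder.Language.{u₁, v}} (K : Set (CategoryTheory.Bundled.{w} L.Structure)) :
    Prop :=
  ∀ A ∈ K, ∀ B ∈ K, ∀ k : ℕ, 1 ≤ k → ∃ C ∈ K, ∀ c : copies L C A → Fin k,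
    ∃ B' ∈ copies L C B, ∀ A' A'' : copies L C A,
      (A' : L.Substructure C) ≤ B' → (A'' : L.Substructure C) ≤ B' → c A' = c A''

/-- A structure has the Ramsey property if its age does. -/
def HasRP (L : FirstOrder.Language.{u₁, v}) (M : Type w) [L.Structure M] : Prop :=
  RamseyProperty (L.age M)

/-- The symbols of `L₁ ∪ L₂ ∪ {E}`, where `L₁ = {<} ∪ σ₁`, `L₂ = {<} ∪ σ₂` and
`L₁ ∩ L₂ = {<}`. -/
inductive SemidirectRel (σ₁ : ℕ → Type u₁) (σ₂ : ℕ → Type u₂) : ℕ → Type (max u₁ u₂)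
  | lt : SemidirectRel σ₁ σ₂ 2
  | E : SemidirectRel σ₁ σ₂ 2
  | fiber {n : ℕ} (R : σ₁ n) : SemidirectRel σ₁ σ₂ n
  | base {n : ℕ} (R : σ₂ n) : SemidirectRel σ₁ σ₂ n

/-- The relational language `L₁ ∪ L₂ ∪ {E}`. -/
def semidirectLanguage (σ₁ : ℕ → Type u₁) (σ₂ : ℕ → Type u₂) :
    FirstOrder.Language.{0, max u₁ u₂} where
  Functions := fun _ => Empty
  Relations := SemidirectRel σ₁ σ₂

/-- The domain of the semi-direct product structure: the disjoint union of the `M i`. -/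
def SemidirectUnion (I : Type v) (M : I → Type w) : Type (max v w) := Σ i, M i

/-- The semi-direct product structure on the disjoint union of the `M i`. -/
instance semidirectStructure (σ₁ : ℕ → Type u₁) (σ₂ : ℕ → Type u₂)
    (I : Type v) [(ordLanguage σ₂).Structure I]
    (M : I → Type w) [∀ i, (ordLanguage σ₁).Structure (M i)] :
    (semidirectLanguage σ₁ σ₂).Structure (SemidirectUnion I M) where
  funMap := fun f _ => nomatch f
  RelMap := fun {_} r => match r with
    | SemidirectRel.lt => fun x : Fin 2 → Σ i, M i =>
        FirstOrder.Language.Structure.RelMap (L := ordLanguage σ₂) (OrdRel.lt : OrdRel σ₂ 2)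
            ![(x 0).1, (x 1).1] ∨
          ∃ (i : I) (a b : M i), x 0 = ⟨i, a⟩ ∧ x 1 = ⟨i, b⟩ ∧
            FirstOrder.Language.Structure.RelMap (L := ordLanguage σ₁) (OrdRel.lt : OrdRel σ₁ 2) ![a, b]
    | SemidirectRel.E => fun x : Fin 2 → Σ i, M i => (x 0).1 = (x 1).1
    | SemidirectRel.fiber (n := n) R => fun x : Fin n → Σ i, M i =>
        ∃ (i : I) (a : Fin n → M i), (∀ j, x j = ⟨i, a j⟩) ∧
          FirstOrder.Language.Structure.RelMap (L := ordLanguage σ₁) (OrdRel.rel R : OrdRel σ₁ n) a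
    | SemidirectRel.base (n := n) R => fun x : Fin n → Σ i, M i =>
        FirstOrder.Language.Structure.RelMap (L := ordLanguage σ₂) (OrdRel.rel R : OrdRel σ₂ n)
          fun j => (x j).1

/-! A nonempty finite substructure of the semi-direct product is, up to isomorphism, a semi-direct
product with base in the age of `I` and nonempty fibres in `K`. Embeddings of such products are
pairs of a base embedding `h` and fibre embeddings `d i`. The linear order makes finite structures
rigid, so the two Ramsey hypotheses pass from copies to embeddings.

All fibres of both structures `A` and `B` embed in one `D ∈ K`. Choose a base `C₀` that is Ramsey
for the bases `A₀`, `B₀`, then fibres over the points of `C₀` by a product Ramsey theorem for `K`: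
some maps `g x` from `D` into these fibres make the colour of `(h, d)`, for each of the finitely
many `h`, the same for all `d` factoring through `g`. The colour then depends on `h` alone, and the
choice of `C₀` makes it constant (`exists_embeddingArrow`). The product theorem
(`MorphismRamsey.exists_pi`) is an induction on coordinates: one coordinate is coloured by functions
of the others. -/

/-! ### Product Ramsey theorems in a category -/

section ProductRamsey

open CategoryTheory

/-- The Ramsey property for morphisms of a category. -/
def MorphismRamsey (𝒞 : Type*) [Category 𝒞] : Prop :=
  ∀ (A B : 𝒞) (k : ℕ), ∃ D : 𝒞, ∀ c : (A ⟶ D) → Fin (k + 1),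
    ∃ g : B ⟶ D, ∀ u u' : A ⟶ B, c (u ≫ g) = c (u' ≫ g)

variable {𝒞 : Type*} [Category 𝒞]

/-- Colourings may take values in any finite type. -/
theorem MorphismRamsey.exists_of_finite (h𝒞 : MorphismRamsey 𝒞) (A B : 𝒞)
    (κ : Type*) [Finite κ] :
    ∃ D : 𝒞, ∀ c : (A ⟶ D) → κ, ∃ g : B ⟶ D, ∀ u u' : A ⟶ B, c (u ≫ g) = c (u' ≫ g) := by
  obtain ⟨n, ⟨e⟩⟩ := Finite.exists_equiv_fin κ
  obtain ⟨D, hD⟩ := h𝒞 A B n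
  refine ⟨D, fun c => ?_⟩
  -- The spare colour keeps the palette nonempty even when `κ` is empty.
  obtain ⟨g, hg⟩ := hD fun u => (e (c u)).castSucc
  exact ⟨g, fun u u' => e.injective (Fin.castSucc_injective n (hg u u'))⟩

/-- Finitely many domains can be coloured simultaneously. -/
theorem MorphismRamsey.exists_of_finite_family (h𝒞 : MorphismRamsey 𝒞) {P : Type*} [Finite P]
    (A : P → 𝒞) (B : 𝒞) (κ : Type*) [Finite κ] :
    ∃ D : 𝒞, ∀ c : ∀ p, (A p ⟶ D) → κ,
      ∃ g : B ⟶ D, ∀ p, ∀ u u' : A p ⟶ B, c p (u ≫ g) = c p (u' ≫ g) := by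
  classical
  suffices H : ∀ s : Finset P, ∃ D : 𝒞, ∀ c : ∀ p, (A p ⟶ D) → κ,
      ∃ g : B ⟶ D, ∀ p ∈ s, ∀ u u' : A p ⟶ B, c p (u ≫ g) = c p (u' ≫ g) by
    cases nonempty_fintype P
    simpa using H Finset.univ
  intro s
  induction s using Finset.induction_on with
  | empty => exact ⟨B, fun _ => ⟨𝟙 B, by simp⟩⟩
  | insert p s _ ih =>
    obtain ⟨D', hD'⟩ := ih
    -- With `D'` as target, the colour for `p` is constant on everything through `g₁`, so the later
    -- choice of `g₂` cannot spoil it.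
    obtain ⟨D, hD⟩ := h𝒞.exists_of_finite (A p) D' κ
    refine ⟨D, fun c => ?_⟩
    obtain ⟨g₁, hg₁⟩ := hD (c p)
    obtain ⟨g₂, hg₂⟩ := hD' fun q v => c q (v ≫ g₁)
    refine ⟨g₂ ≫ g₁, fun q hq u u' => ?_⟩
    rcases Finset.mem_insert.1 hq with rfl | hq
    · simpa using hg₁ (u ≫ g₂) (u' ≫ g₂)
    · simpa using hg₂ q hq u u'

/-- The product Ramsey theorem: in each coordinate a morphism out of some `A p` is chosen. -/
theorem MorphismRamsey.exists_pi_fin (h𝒞 : MorphismRamsey 𝒞) [∀ X Y : 𝒞, Finite (X ⟶ Y)]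
    {P : Type v} [Finite P] (A : P → 𝒞) (B : 𝒞) (ι : ∀ p, A p ⟶ B) (n : ℕ)
    (κ : Type v) [Finite κ] :
    ∃ D : Fin n → 𝒞, ∀ c : (∀ x, Σ p, (A p ⟶ D x)) → κ,
      ∃ g : ∀ x, B ⟶ D x, ∀ (t : Fin n → P) (u u' : ∀ x, A (t x) ⟶ B),
        c (fun x => ⟨t x, u x ≫ g x⟩) = c (fun x => ⟨t x, u' x ≫ g x⟩) := by
  induction n generalizing κ with
  | zero =>
    exact ⟨fun x => x.elim0, fun c => ⟨fun x => x.elim0, fun t u u' =>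
      congrArg c (funext fun x => x.elim0)⟩⟩
  | succ n ih =>
    -- Once coordinate 0 is homogeneous, only the index `p` of its domain matters, so the remaining
    -- coordinates are coloured by functions of `p`; `ι p` serves as the representative.
    obtain ⟨D', hD'⟩ := ih (P → κ)
    obtain ⟨D₀, hD₀⟩ := h𝒞.exists_of_finite_family A B ((∀ x, Σ p, (A p ⟶ D' x)) → κ)
    let D : Fin (n + 1) → 𝒞 := Fin.cons D₀ D'
    refine ⟨D, fun c => ?_⟩
    let glue : (Σ p, (A p ⟶ D₀)) → (∀ x, Σ p, (A p ⟶ D' x)) → ∀ x, Σ p, (A p ⟶ D x) :=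
      fun v w => Fin.cons (α := fun x => Σ p, (A p ⟶ D x)) v w
    obtain ⟨g₀, hg₀⟩ := hD₀ fun p v w => c (glue ⟨p, v⟩ w)
    obtain ⟨g', hg'⟩ := hD' fun w p => c (glue ⟨p, ι p ≫ g₀⟩ w)
    refine ⟨Fin.cons (α := fun x => B ⟶ D x) g₀ g', fun t u u' => ?_⟩
    have key : ∀ u : ∀ x, A (t x) ⟶ B,
        c (fun x => ⟨t x, u x ≫ Fin.cons (α := fun x => B ⟶ D x) g₀ g' x⟩) =
          c (glue ⟨t 0, ι (t 0) ≫ g₀⟩ fun x => ⟨t x.succ, u x.succ ≫ g' x⟩) := by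
      intro u
      refine Eq.trans (congrArg c ?_) (congrFun (hg₀ (t 0) (u 0) (ι (t 0))) _)
      funext x
      refine Fin.cases ?_ (fun x => ?_) x <;> rfl
    rw [key u, key u']
    exact congrFun (hg' (fun x => t x.succ) (fun x => u x.succ) fun x => u' x.succ) (t 0)

/-- The product Ramsey theorem for finitely many injective placements `h t` of the objects `A p`
into the coordinates. -/
theorem MorphismRamsey.exists_pi (h𝒞 : MorphismRamsey 𝒞) [∀ X Y : 𝒞, Finite (X ⟶ Y)]
    {T P X : Type v} [Finite T] [Finite P] [Nonempty P] [Finite X] (h : T → P → X)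
    (hinj : ∀ t, Function.Injective (h t)) (A : P → 𝒞) (B : 𝒞) (ι : ∀ p, A p ⟶ B)
    (κ : Type) [Finite κ] :
    ∃ D : X → 𝒞, ∀ c : ∀ t : T, (∀ p, A p ⟶ D (h t p)) → κ,
      ∃ g : ∀ x, B ⟶ D x, ∀ (t : T) (u u' : ∀ p, A p ⟶ B),
        c t (fun p => u p ≫ g (h t p)) = c t (fun p => u' p ≫ g (h t p)) := by
  classical
  obtain ⟨n, ⟨e⟩⟩ := Finite.exists_equiv_fin X
  obtain ⟨D, hD⟩ := h𝒞.exists_pi_fin A B ι n (T → Option κ)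
  refine ⟨fun x => D (e x), fun c => ?_⟩
  -- One colouring of full tuples records all the `c t`; `none` marks tuples whose domains do not
  -- match the placement `h t`.
  obtain ⟨g, hg⟩ := hD fun w t =>
    if H : ∀ p, (w (e (h t p))).1 = p then
      some (c t fun p => eqToHom (congrArg A (H p).symm) ≫ (w (e (h t p))).2)
    else none
  refine ⟨fun x => g (e x), fun t u u' => ?_⟩
  -- Coordinates outside the range of `h t` receive an arbitrary domain.
  let r : Fin n → P := fun y => Function.invFun (h t) (e.symm y)
  have hr : ∀ p, r (e (h t p)) = p := fun p => by
    simp only [r, Equiv.symm_apply_apply]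
    exact Function.leftInverse_invFun (hinj t) p
  have key := congrFun (hg r (fun y => u (r y)) fun y => u' (r y)) t
  have cancel : ∀ (u : ∀ p, A p ⟶ B) (p q : P) (hqp : q = p) (Y : 𝒞) (f : B ⟶ Y),
      eqToHom (congrArg A hqp.symm) ≫ u q ≫ f = u p ≫ f := by
    rintro u p _ rfl Y f
    simp
  simp only [hr, implies_true, dite_true, Option.some.injEq] at key
  simpa only [cancel _ _ _ (hr _)] using key

end ProductRamsey

/-! ### Copies versus embeddings -/

section Copies

open FirstOrder FirstOrder.Language CategoryTheory

instance ordLanguage_isRelational (σ : ℕ → Type v) : (ordLanguage σ).IsRelational :=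
  fun _ => inferInstanceAs (IsEmpty Empty)

instance semidirectLanguage_isRelational (σ₁ : ℕ → Type u₁) (σ₂ : ℕ → Type u₂) :
    (semidirectLanguage σ₁ σ₂).IsRelational :=
  fun _ => inferInstanceAs (IsEmpty Empty)

/-- The members of a class of structures, as objects of a category. -/
structure ClassObj {L : FirstOrder.Language.{u₁, v}} (K : Set (Bundled.{w} L.Structure)) where
  /-- The underlying structure. -/
  obj : Bundled.{w} L.Structure
  mem : obj ∈ K

/-- A class of structures as a category whose morphisms are the embeddings. -/
instance classCategory {L : FirstOrder.Language.{u₁, v}} (K : Set (Bundled.{w} L.Structure)) :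
    Category (ClassObj K) where
  Hom X Y := X.obj ↪[L] Y.obj
  id X := Embedding.refl L X.obj
  comp f g := g.comp f

/-- A finite colouring of the embeddings of `A` into `C` has a copy of `B` on which it is
constant. -/
def EmbeddingArrow (L : FirstOrder.Language.{u₁, v}) (A B C : Type w) [L.Structure A] [L.Structure B]
    [L.Structure C] (k : ℕ) : Prop :=
  ∀ c : (A ↪[L] C) → Fin k, ∃ g : B ↪[L] C, ∀ u u' : A ↪[L] B, c (g.comp u) = c (g.comp u')

theorem EmbeddingArrow.exists_copy {L : FirstOrder.Language.{u₁, v}} {A B C : Type w} [L.Structure A]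
    [L.Structure B] [L.Structure C] {k : ℕ} (h : EmbeddingArrow L A B C k)
    (c : copies L C A → Fin k) :
    ∃ B' ∈ copies L C B, ∀ A' A'' : copies L C A,
      (A' : L.Substructure C) ≤ B' → (A'' : L.Substructure C) ≤ B' → c A' = c A'' := by
  -- An embedding gets the colour of its range.
  obtain ⟨g, hg⟩ := h fun e => c ⟨e.toHom.range, ⟨e.equivRange.symm⟩⟩
  have factor : ∀ A' : L.Substructure C, A' ∈ copies L C A → A' ≤ g.toHom.range →
      ∃ u : A ↪[L] B, (g.comp u).toHom.range = A' := by
    rintro A' ⟨φ⟩ hA'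
    refine ⟨g.equivRange.symm.toEmbedding.comp
      ((Substructure.inclusion hA').comp φ.symm.toEmbedding), ?_⟩
    have hval : ∀ x : A, g (g.equivRange.symm (Substructure.inclusion hA' (φ.symm x))) =
        φ.symm x := fun x => by
      rw [← Embedding.equivRange_apply, Language.Equiv.apply_symm_apply]
      rfl
    ext y
    constructor
    · rintro ⟨x, rfl⟩
      exact (hval x).symm ▸ (φ.symm x).2
    · intro hy
      refine ⟨φ ⟨y, hy⟩, (hval _).trans ?_⟩
      rw [Language.Equiv.symm_apply_apply]
  refine ⟨g.toHom.range, ⟨g.equivRange.symm⟩, fun A' A'' h' h'' => ?_⟩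
  obtain ⟨u', hu'⟩ := factor A' A'.2 h'
  obtain ⟨u'', hu''⟩ := factor A'' A''.2 h''
  exact ((congrArg c (Subtype.ext hu'.symm)).trans (hg u' u'')).trans
    (congrArg c (Subtype.ext hu''))

/-- The relation interpreting `<`. -/
def ordLt (σ : ℕ → Type v) {M : Type*} [(ordLanguage σ).Structure M] (a b : M) : Prop :=
  Structure.RelMap (L := ordLanguage σ) (OrdRel.lt : OrdRel σ 2) ![a, b]

/-- The relation interpreting a symbol other than `<`. -/
def ordRel {σ : ℕ → Type v} {M : Type*} [(ordLanguage σ).Structure M] {n : ℕ} (R : σ n)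
    (a : Fin n → M) : Prop :=
  Structure.RelMap (L := ordLanguage σ) (OrdRel.rel R : OrdRel σ n) a

theorem ordLt_map {σ : ℕ → Type v} {M N : Type*} [(ordLanguage σ).Structure M]
    [(ordLanguage σ).Structure N] (f : M ↪[ordLanguage σ] N) (a b : M) :
    ordLt σ (f a) (f b) ↔ ordLt σ a b := by
  have h := f.map_rel (OrdRel.lt : OrdRel σ 2) ![a, b]
  have e : f ∘ ![a, b] = ![f a, f b] := by
    funext i
    fin_cases i <;> rfl
  rwa [e] at h

theorem ordRel_map {σ : ℕ → Type v} {M N : Type*} [(ordLanguage σ).Structure M]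
    [(ordLanguage σ).Structure N] (f : M ↪[ordLanguage σ] N) {n : ℕ} (R : σ n) (a : Fin n → M) :
    ordRel R (fun j => f (a j)) ↔ ordRel R a :=
  f.map_rel (OrdRel.rel R : OrdRel σ n) a

theorem IsOrderedStructure.isStrictTotalOrder {σ : ℕ → Type v} {M : Type*}
    [(ordLanguage σ).Structure M] (h : IsOrderedStructure σ M) :
    IsStrictTotalOrder M (ordLt σ) := h

theorem IsOrderedStructure.not_ordLt_self {σ : ℕ → Type v} {M : Type*}
    [(ordLanguage σ).Structure M] (h : IsOrderedStructure σ M) (a : M) : ¬ ordLt σ a a :=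
  h.isStrictTotalOrder.irrefl a

theorem IsOrderedStructure.of_embedding {σ : ℕ → Type v} {M N : Type*}
    [(ordLanguage σ).Structure M] [(ordLanguage σ).Structure N] (hN : IsOrderedStructure σ N)
    (f : M ↪[ordLanguage σ] N) : IsOrderedStructure σ M := by
  have := hN.isStrictTotalOrder
  exact (RelEmbedding.mk (s := ordLt σ) f.toEmbedding
    (fun {a b} => ordLt_map f a b)).isStrictTotalOrder

/-- Embeddings of a finite ordered structure are determined by their range. -/
theorem IsOrderedStructure.embedding_ext {σ : ℕ → Type v} {A C : Type*} [Finite A]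
    [(ordLanguage σ).Structure A] [(ordLanguage σ).Structure C] (hA : IsOrderedStructure σ A)
    (hC : IsOrderedStructure σ C) {f g : A ↪[ordLanguage σ] C}
    (h : Set.range f = Set.range g) : f = g := by
  classical
  have := hA.isStrictTotalOrder
  have := hC.isStrictTotalOrder
  let _ : LinearOrder A := linearOrderOfSTO (ordLt σ)
  let _ : LinearOrder C := linearOrderOfSTO (ordLt σ)
  have mono : ∀ f : A ↪[ordLanguage σ] C, StrictMono f := fun f a b hab =>
    (ordLt_map f a b).2 hab
  exact DFunLike.coe_injective (((mono f).range_inj (mono g)).1 h)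

/-- By rigidity each copy of `A` is the range of exactly one embedding, so a colouring of embeddings
is a colouring of copies. -/
theorem RamseyProperty.morphismRamsey {σ : ℕ → Type v}
    {K : Set (Bundled.{w} (ordLanguage σ).Structure)} (hK : RamseyProperty K)
    (hfin : ∀ N ∈ K, Finite N) (hord : ∀ N ∈ K, IsOrderedStructure σ N) :
    MorphismRamsey (ClassObj K) := by
  rintro ⟨A, hA⟩ ⟨B, hB⟩ k
  obtain ⟨C, hC, hCR⟩ := hK A hA B hB (k + 1) (by omega)
  refine ⟨⟨C, hC⟩, fun (c : (A ↪[ordLanguage σ] C) → Fin (k + 1)) => ?_⟩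
  have := hfin A hA
  let emb : copies (ordLanguage σ) C A → (A ↪[ordLanguage σ] C) := fun S =>
    (Substructure.subtype _).comp S.2.some.symm.toEmbedding
  have range_emb : ∀ S, Set.range (emb S) = (S.1 : Set C) := fun S => by
    ext y
    constructor
    · rintro ⟨x, rfl⟩
      exact (S.2.some.symm x).2
    · intro hy
      exact ⟨S.2.some ⟨y, hy⟩, by simp [emb]⟩
  obtain ⟨B', ⟨ψ⟩, hB'⟩ := hCR fun S => c (emb S)
  let g : B ↪[ordLanguage σ] C := (Substructure.subtype _).comp ψ.symm.toEmbedding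
  refine ⟨g, fun (u u' : A ↪[ordLanguage σ] B) => ?_⟩
  change c (g.comp u) = c (g.comp u')
  let S : (A ↪[ordLanguage σ] B) → copies (ordLanguage σ) C A := fun u =>
    ⟨(g.comp u).toHom.range, ⟨(g.comp u).equivRange.symm⟩⟩
  have hS : ∀ u, (S u : (ordLanguage σ).Substructure C) ≤ B' := by
    rintro u _ ⟨x, rfl⟩
    exact (ψ.symm (u x)).2
  have hemb : ∀ u, emb (S u) = g.comp u := fun u =>
    (hord A hA).embedding_ext (hord C hC) (range_emb (S u))
  rw [← hemb u, ← hemb u']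
  exact hB' _ _ (hS u) (hS u')

end Copies

/-! ### Embeddings and colourings of semi-direct products -/

section Semidirect

open FirstOrder FirstOrder.Language CategoryTheory

/-- An embedding of structures in the language `{<} ∪ σ`. -/
def ordEmbedding {σ : ℕ → Type v} {M N : Type*} [(ordLanguage σ).Structure M]
    [(ordLanguage σ).Structure N] (f : M → N) (hf : Function.Injective f)
    (hlt : ∀ a b, ordLt σ (f a) (f b) ↔ ordLt σ a b)
    (hrel : ∀ (n : ℕ) (R : σ n) (a : Fin n → M), ordRel R (fun j => f (a j)) ↔ ordRel R a) :
    M ↪[ordLanguage σ] N where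
  toFun := f
  inj' := hf
  map_fun' := fun g => isEmptyElim g
  map_rel' := fun {n} r => match n, r with
    | _, OrdRel.lt => fun x => by
      have h := hlt (x 0) (x 1)
      have e : ![x 0, x 1] = x := by
        funext i
        fin_cases i <;> rfl
      have e' : ![f (x 0), f (x 1)] = f ∘ x := by
        funext i
        fin_cases i <;> rfl
      unfold ordLt at h
      rwa [e, e'] at h
    | _, OrdRel.rel R => hrel _ R

/-- All members of a family of structures satisfy the same nullary relations. -/
def NullaryAgree (σ : ℕ → Type u₁) {I : Type v} (M : I → Type w)
    [∀ i, (ordLanguage σ).Structure (M i)] : Prop :=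
  ∀ (R : σ 0) (i j : I) (x : Fin 0 → M i) (y : Fin 0 → M j), ordRel R x ↔ ordRel R y

namespace SemidirectUnion

variable {σ₁ : ℕ → Type u₁} {σ₂ : ℕ → Type u₂}

section Relations

variable {I : Type v} [(ordLanguage σ₂).Structure I]
  {M : I → Type w} [∀ i, (ordLanguage σ₁).Structure (M i)]

/-- The order of the semi-direct product. -/
def lt (σ₁ : ℕ → Type u₁) (σ₂ : ℕ → Type u₂) {I : Type v} [(ordLanguage σ₂).Structure I]
    {M : I → Type w} [∀ i, (ordLanguage σ₁).Structure (M i)] (x y : SemidirectUnion I M) : Prop :=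
  ordLt σ₂ x.1 y.1 ∨ ∃ (i : I) (a b : M i), x = ⟨i, a⟩ ∧ y = ⟨i, b⟩ ∧ ordLt σ₁ a b

/-- The interpretation of a symbol of the fibers. -/
def fiberRel {n : ℕ} (R : σ₁ n) (x : Fin n → SemidirectUnion I M) : Prop :=
  ∃ (i : I) (a : Fin n → M i), (∀ j, x j = ⟨i, a j⟩) ∧ ordRel R a

theorem lt_iff_of_fst_ne {x y : SemidirectUnion I M} (h : x.1 ≠ y.1) :
    lt σ₁ σ₂ x y ↔ ordLt σ₂ x.1 y.1 := by
  refine ⟨?_, Or.inl⟩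
  rintro (h' | ⟨i, a, b, rfl, rfl, -⟩)
  · exact h'
  · exact absurd rfl h

theorem lt_mk_iff (hI : IsOrderedStructure σ₂ I) (i : I) (a b : M i) :
    lt σ₁ σ₂ (⟨i, a⟩ : SemidirectUnion I M) ⟨i, b⟩ ↔ ordLt σ₁ a b := by
  refine ⟨?_, fun h => Or.inr ⟨i, a, b, rfl, rfl, h⟩⟩
  rintro (h | ⟨j, a', b', ha, hb, h⟩)
  · exact absurd h (hI.not_ordLt_self i)
  · cases ha
    cases hb
    exact h

/-- Any entry of a nonempty tuple determines its fibre; the empty tuple does not, hence the need for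
nullary agreement. -/
theorem fiberRel_mk_iff (hM : NullaryAgree σ₁ M) {n : ℕ} (R : σ₁ n) (i : I) (a : Fin n → M i) :
    fiberRel R (fun j => (⟨i, a j⟩ : SemidirectUnion I M)) ↔ ordRel R a := by
  refine ⟨?_, fun h => ⟨i, a, fun _ => rfl, h⟩⟩
  rintro ⟨i', a', h, h'⟩
  cases n with
  | zero => exact (hM R i i' a a').2 h'
  | succ n =>
    obtain rfl : i = i' := congrArg Sigma.fst (h 0)
    obtain rfl : a = a' := funext fun j => eq_of_heq (Sigma.mk.inj (h j)).2
    exact h'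

end Relations

variable {I : Type*} [(ordLanguage σ₂).Structure I]
  {M : I → Type*} [∀ i, (ordLanguage σ₁).Structure (M i)]
  {I' : Type*} [(ordLanguage σ₂).Structure I']
  {M' : I' → Type*} [∀ i, (ordLanguage σ₁).Structure (M' i)]

section Embedding

variable (f : SemidirectUnion I' M' ↪[semidirectLanguage σ₁ σ₂] SemidirectUnion I M)

theorem fst_map_eq_iff (x y : SemidirectUnion I' M') : (f x).1 = (f y).1 ↔ x.1 = y.1 :=
  f.map_rel (SemidirectRel.E : SemidirectRel σ₁ σ₂ 2) ![x, y]

theorem lt_map_iff (x y : SemidirectUnion I' M') :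
    lt σ₁ σ₂ (f x) (f y) ↔ lt σ₁ σ₂ x y :=
  f.map_rel (SemidirectRel.lt : SemidirectRel σ₁ σ₂ 2) ![x, y]

theorem fiberRel_map_iff {n : ℕ} (R : σ₁ n) (x : Fin n → SemidirectUnion I' M') :
    fiberRel R (fun j => f (x j)) ↔ fiberRel R x :=
  f.map_rel (SemidirectRel.fiber R : SemidirectRel σ₁ σ₂ n) x

theorem baseRel_map_iff {n : ℕ} (R : σ₂ n) (x : Fin n → SemidirectUnion I' M') :
    ordRel R (fun j => (f (x j)).1) ↔ ordRel R fun j => (x j).1 :=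
  f.map_rel (SemidirectRel.base R : SemidirectRel σ₁ σ₂ n) x

/-- Every embedding of semi-direct products with nonempty fibers is induced by an embedding of
the bases and embeddings of the fibers. -/
theorem exists_eq_mk_of_embedding (hI : IsOrderedStructure σ₂ I) (hI' : IsOrderedStructure σ₂ I')
    (hM : NullaryAgree σ₁ M) (hM' : NullaryAgree σ₁ M') (hne : ∀ i, Nonempty (M' i)) :
    ∃ (h : I' ↪[ordLanguage σ₂] I) (d : ∀ i, M' i ↪[ordLanguage σ₁] M (h i)),
      ∀ (i : I') (a : M' i), f ⟨i, a⟩ = ⟨h i, d i a⟩ := by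
  -- Preservation of `E` makes the choice of point in the fibre irrelevant.
  let h : I' → I := fun i => (f ⟨i, (hne i).some⟩).1
  have hfst : ∀ i (a : M' i), (f ⟨i, a⟩).1 = h i := fun i a => (fst_map_eq_iff f _ _).2 rfl
  have hd : ∀ i (a : M' i), ∃ b : M (h i), f ⟨i, a⟩ = ⟨h i, b⟩ := fun i a =>
    ⟨hfst i a ▸ (f ⟨i, a⟩).2, Sigma.ext (hfst i a) (by simp)⟩
  choose d hd using hd
  have hinj : Function.Injective h := fun i j hij => (fst_map_eq_iff f _ _).1 hij
  refine ⟨ordEmbedding h hinj ?_ ?_, fun i => ordEmbedding (d i) ?_ ?_ ?_, fun i a => hd i a⟩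
  · intro i j
    by_cases hij : i = j
    · subst hij
      exact iff_of_false (hI.not_ordLt_self _) (hI'.not_ordLt_self _)
    · have key := lt_map_iff f ⟨i, (hne i).some⟩ ⟨j, (hne j).some⟩
      exact (lt_iff_of_fst_ne (hinj.ne hij)).symm.trans (key.trans (lt_iff_of_fst_ne hij))
  · exact fun n R t => baseRel_map_iff f R fun j => ⟨t j, (hne (t j)).some⟩
  · intro a b hab
    have : (⟨i, a⟩ : SemidirectUnion I' M') = ⟨i, b⟩ := f.injective (by rw [hd, hd, hab])
    exact eq_of_heq (Sigma.mk.inj this).2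
  · intro a b
    have key := lt_map_iff f ⟨i, a⟩ ⟨i, b⟩
    rwa [hd, hd, lt_mk_iff hI, lt_mk_iff hI'] at key
  · intro n R a
    have key := fiberRel_map_iff f R fun j => ⟨i, a j⟩
    simp only [hd] at key
    rwa [fiberRel_mk_iff hM, fiberRel_mk_iff hM'] at key

end Embedding

/-- The embedding of semi-direct products induced by an embedding of the bases and embeddings of
the fibers. -/
def map [Nonempty I'] (hM : NullaryAgree σ₁ M) (h : I' ↪[ordLanguage σ₂] I)
    (d : ∀ i, M' i ↪[ordLanguage σ₁] M (h i)) :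
    SemidirectUnion I' M' ↪[semidirectLanguage σ₁ σ₂] SemidirectUnion I M where
  toFun x := ⟨h x.1, d x.1 x.2⟩
  inj' := by
    rintro ⟨i, a⟩ ⟨j, b⟩ hab
    obtain rfl : i = j := h.injective (congrArg Sigma.fst hab)
    exact congrArg (Sigma.mk i) ((d i).injective (eq_of_heq (Sigma.mk.inj hab).2))
  map_fun' := fun g => isEmptyElim g
  map_rel' := fun {n} r => match n, r with
    | _, SemidirectRel.lt => fun x => by
      change lt σ₁ σ₂ (⟨h (x 0).1, d _ (x 0).2⟩ : SemidirectUnion I M) ⟨h (x 1).1, d _ (x 1).2⟩ ↔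
        lt σ₁ σ₂ (x 0) (x 1)
      generalize x 0 = y
      generalize x 1 = z
      constructor
      · rintro (hlt | ⟨i, a, b, ha, hb, hlt⟩)
        · exact Or.inl ((ordLt_map h _ _).1 hlt)
        · obtain ⟨j, a'⟩ := y
          obtain ⟨j', b'⟩ := z
          obtain rfl : h j = i := congrArg Sigma.fst ha
          obtain rfl : j' = j := h.injective (congrArg Sigma.fst hb)
          obtain rfl : d _ a' = a := eq_of_heq (Sigma.mk.inj ha).2
          obtain rfl : d _ b' = b := eq_of_heq (Sigma.mk.inj hb).2
          exact Or.inr ⟨_, a', b', rfl, rfl, (ordLt_map _ _ _).1 hlt⟩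
      · rintro (hlt | ⟨i, a, b, rfl, rfl, hlt⟩)
        · exact Or.inl ((ordLt_map h _ _).2 hlt)
        · exact Or.inr ⟨_, _, _, rfl, rfl, (ordLt_map _ _ _).2 hlt⟩
    | _, SemidirectRel.E => fun x => h.injective.eq_iff
    | n, SemidirectRel.fiber R => fun x => by
      change fiberRel R (fun j => (⟨h (x j).1, d _ (x j).2⟩ : SemidirectUnion I M)) ↔ fiberRel R x
      constructor
      · rintro ⟨i, a, ha, hR⟩
        cases n with
        | zero =>
          obtain ⟨i'⟩ := ‹Nonempty I'›
          refine ⟨i', fun j => j.elim0, fun j => j.elim0, ?_⟩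
          rw [← ordRel_map (d i')]
          exact (hM R _ _ _ _).1 hR
        | succ n =>
          have hx : ∀ j, (x j).1 = (x 0).1 := fun j =>
            h.injective ((congrArg Sigma.fst (ha j)).trans (congrArg Sigma.fst (ha 0)).symm)
          have hx' : ∀ j, ∃ b : M' (x 0).1, x j = ⟨(x 0).1, b⟩ := fun j =>
            ⟨hx j ▸ (x j).2, Sigma.ext (hx j) (by simp)⟩
          choose b hb using hx'
          refine ⟨_, b, hb, ?_⟩
          generalize (x 0).1 = i' at b hb
          obtain rfl : x = fun j => ⟨i', b j⟩ := funext hb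
          obtain rfl : h i' = i := congrArg Sigma.fst (ha 0)
          obtain rfl : (fun j => d i' (b j)) = a :=
            funext fun j => eq_of_heq (Sigma.mk.inj (ha j)).2
          exact (ordRel_map _ _ _).1 hR
      · rintro ⟨i, a, ha, hR⟩
        obtain rfl : x = fun j => ⟨i, a j⟩ := funext ha
        exact ⟨h i, fun j => d i (a j), fun _ => rfl, (ordRel_map _ _ _).2 hR⟩
    | _, SemidirectRel.base R => fun x => ordRel_map h R fun j => (x j).1

end SemidirectUnion

theorem finite_embedding {L : FirstOrder.Language} {M N : Type*} [L.Structure M] [L.Structure N]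
    [Finite M] [Finite N] : Finite (M ↪[L] N) :=
  Finite.of_injective (fun f : M ↪[L] N => (f : M → N)) DFunLike.coe_injective

/-- The Ramsey property of semi-direct products, for colourings of embeddings. -/
theorem exists_embeddingArrow {σ₁ : ℕ → Type u₁} {σ₂ : ℕ → Type u₂}
    {J : Set (Bundled.{v} (ordLanguage σ₂).Structure)}
    {K : Set (Bundled.{w} (ordLanguage σ₁).Structure)}
    (hJ : MorphismRamsey (ClassObj J)) (hJfin : ∀ N ∈ J, Finite N)
    (hJord : ∀ N ∈ J, IsOrderedStructure σ₂ N)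
    (hK : MorphismRamsey (ClassObj K)) (hKfin : ∀ N ∈ K, Finite N)
    (hKnull : NullaryAgree σ₁ fun N : ClassObj K => N.obj)
    (A₀ B₀ : ClassObj J) [Nonempty A₀.obj] [Nonempty B₀.obj]
    (A : A₀.obj → ClassObj K) (B : B₀.obj → ClassObj K)
    (hA : ∀ i, Nonempty (A i).obj)
    (D : ClassObj K) (α : ∀ i, A i ⟶ D) (β : ∀ i, B i ⟶ D) (k : ℕ) :
    ∃ (C₀ : ClassObj J) (C : C₀.obj → ClassObj K), Nonempty C₀.obj ∧
      EmbeddingArrow (semidirectLanguage σ₁ σ₂) (SemidirectUnion A₀.obj fun i => (A i).obj)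
        (SemidirectUnion B₀.obj fun i => (B i).obj) (SemidirectUnion C₀.obj fun i => (C i).obj)
        (k + 1) := by
  have : ∀ X Y : ClassObj K, Finite (X ⟶ Y) := fun X Y => by
    have := hKfin _ X.mem
    have := hKfin _ Y.mem
    exact finite_embedding
  obtain ⟨C₀, hC₀⟩ := hJ A₀ B₀ k
  have := hJfin _ A₀.mem
  have := hJfin _ C₀.mem
  have hne : Nonempty C₀.obj := by
    -- A constant colouring extracts an embedding of `B₀`.
    obtain ⟨g : B₀.obj ↪[ordLanguage σ₂] C₀.obj, -⟩ := hC₀ fun _ => 0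
    exact Nonempty.map g inferInstance
  have := finite_embedding (L := ordLanguage σ₂) (M := A₀.obj) (N := C₀.obj)
  -- The coordinates are the points of `C₀`, and each base embedding is a placement.
  obtain ⟨C, hC⟩ := hK.exists_pi (fun (h : A₀.obj ↪[ordLanguage σ₂] C₀.obj) i => h i)
    (fun h => h.injective) A D α (Fin (k + 1))
  refine ⟨C₀, C, hne, fun c => ?_⟩
  have null : ∀ {X : Type v} (F : X → ClassObj K), NullaryAgree σ₁ fun i => (F i).obj :=
    fun F R i j => hKnull R (F i) (F j)
  obtain ⟨g, hg⟩ := hC fun h d => c (SemidirectUnion.map (null C) h d)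
  obtain ⟨g₀ : B₀.obj ↪[ordLanguage σ₂] C₀.obj, hg₀⟩ :=
    hC₀ fun h : A₀.obj ↪[ordLanguage σ₂] C₀.obj =>
      c (SemidirectUnion.map (null C) h fun i => α i ≫ g (h i))
  refine ⟨SemidirectUnion.map (null C) g₀ fun i => β i ≫ g (g₀ i), ?_⟩
  have key : ∀ u : SemidirectUnion A₀.obj (fun i => (A i).obj) ↪[semidirectLanguage σ₁ σ₂]
      SemidirectUnion B₀.obj (fun i => (B i).obj), ∃ h : A₀.obj ↪[ordLanguage σ₂] B₀.obj,
      c ((SemidirectUnion.map (null C) g₀ fun i => β i ≫ g (g₀ i)).comp u) =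
        c (SemidirectUnion.map (null C) (g₀.comp h) fun i => α i ≫ g (g₀ (h i))) := by
    intro u
    obtain ⟨h, d, hu⟩ := SemidirectUnion.exists_eq_mk_of_embedding u (hJord _ B₀.mem)
      (hJord _ A₀.mem) (null B) (null A) hA
    refine ⟨h, ?_⟩
    -- The fibre part of `u` followed by `β` is a family of maps into `D`; homogeneity along `g`
    -- lets `α` replace it.
    refine Eq.trans (congrArg c ?_) (hg (g₀.comp h) (fun i => Embedding.comp (β (h i)) (d i)) α)
    ext ⟨i, a⟩
    exact congrArg (SemidirectUnion.map (null C) g₀ fun i => β i ≫ g (g₀ i)) (hu i a)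
  intro u u'
  obtain ⟨h, hu⟩ := key u
  obtain ⟨h', hu'⟩ := key u'
  rw [hu, hu']
  exact hg₀ h h'

end Semidirect

/-! ### Ages and finite substructures -/

section Age

open FirstOrder FirstOrder.Language CategoryTheory

/-- In a relational language every set is the carrier of a substructure. -/
def relationalSubstructure {L : FirstOrder.Language} [L.IsRelational] {M : Type*} [L.Structure M]
    (s : Set M) : L.Substructure M where
  carrier := s
  fun_mem := fun f => isEmptyElim f

theorem relationalSubstructure_mem_age {L : FirstOrder.Language} [L.IsRelational] {M : Type w}
    [L.Structure M] {s : Set M} (hs : s.Finite) :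
    (⟨relationalSubstructure (L := L) s, inferInstance⟩ : Bundled L.Structure) ∈ L.age M :=
  ⟨Structure.fg_iff_finite.2 hs, ⟨Substructure.subtype _⟩⟩

theorem finite_of_mem_age {L : FirstOrder.Language} [L.IsRelational] {M : Type w}
    [L.Structure M] {N : Bundled.{w} L.Structure} (hN : N ∈ L.age M) : Finite N :=
  Structure.fg_iff_finite.1 hN.1

/-- Finitely many members of an age embed jointly into a member of the age. -/
theorem exists_joint_embedding_of_mem_age {L : FirstOrder.Language} [L.IsRelational] {M : Type w}
    [L.Structure M] {P : Type*} [Finite P] (A : P → Bundled.{w} L.Structure)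
    (hA : ∀ p, A p ∈ L.age M) : ∃ D ∈ L.age M, ∀ p, Nonempty (A p ↪[L] D) := by
  choose hfg f using hA
  have hfin : ∀ p, Finite (A p) := fun p => Structure.fg_iff_finite.1 (hfg p)
  let s : Set M := ⋃ p, Set.range (f p).some
  refine ⟨_, relationalSubstructure_mem_age (s := s)
    (Set.finite_iUnion fun p => Set.finite_range _), fun p => ⟨?_⟩⟩
  exact (f p).some.codRestrict (relationalSubstructure s)
    fun x => Set.mem_iUnion.2 ⟨p, x, rfl⟩

theorem nonempty_equiv_of_range_eq {L : FirstOrder.Language} {A B C : Type*} [L.Structure A]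
    [L.Structure B] [L.Structure C] (f : A ↪[L] C) (g : B ↪[L] C)
    (h : Set.range f = Set.range g) : Nonempty (A ≃[L] B) := by
  have h' : f.toHom.range = g.toHom.range := SetLike.coe_injective h
  have e : Nonempty (f.toHom.range ≃[L] g.toHom.range) := h' ▸ ⟨Language.Equiv.refl L _⟩
  exact ⟨g.equivRange.symm.comp (e.some.comp f.equivRange)⟩

theorem EmbeddingArrow.of_equiv {L : FirstOrder.Language} {A B A' B' C : Type w} [L.Structure A]
    [L.Structure B] [L.Structure A'] [L.Structure B'] [L.Structure C] {k : ℕ}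
    (h : EmbeddingArrow L A' B' C k) (e : A ≃[L] A') (e' : B ≃[L] B') :
    EmbeddingArrow L A B C k := by
  intro c
  obtain ⟨g, hg⟩ := h fun f => c (f.comp e.toEmbedding)
  refine ⟨g.comp e'.toEmbedding, fun u u' => ?_⟩
  have key := hg (e'.toEmbedding.comp (u.comp e.symm.toEmbedding))
    (e'.toEmbedding.comp (u'.comp e.symm.toEmbedding))
  have cancel : ∀ u : A ↪[L] B,
      (g.comp (e'.toEmbedding.comp (u.comp e.symm.toEmbedding))).comp e.toEmbedding =
        (g.comp e'.toEmbedding).comp u := by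
    intro u
    ext x
    exact congrArg (fun y => g (e' (u y))) (e.symm_apply_apply x)
  rwa [cancel, cancel] at key

/-- Here `B` has at most one copy of `A`, the empty substructure, so `B` itself is a witness. -/
theorem exists_ramsey_of_isEmpty {L : FirstOrder.Language.{u₁, v}} {A B : Type w} [L.Structure A]
    [L.Structure B] (h : IsEmpty A ∨ IsEmpty B) {k : ℕ} (c : copies L B A → Fin k) :
    ∃ B' ∈ copies L B B, ∀ A' A'' : copies L B A,
      (A' : L.Substructure B) ≤ B' → (A'' : L.Substructure B) ≤ B' → c A' = c A'' := by
  refine ⟨⊤, ⟨Substructure.topEquiv⟩, fun A' A'' _ _ => congrArg c (Subtype.ext ?_)⟩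
  have not_mem : ∀ (S : copies L B A) (x : B), x ∉ (S : L.Substructure B) := by
    rintro ⟨S, ⟨φ⟩⟩ x hx
    exact h.elim (fun h => h.false (φ ⟨x, hx⟩)) fun h => h.false x
  ext x
  exact iff_of_false (not_mem A' x) (not_mem A'' x)

variable {σ₁ : ℕ → Type u₁} {σ₂ : ℕ → Type u₂}

theorem nullaryAgree_of_embedding {M N : Type*} [(ordLanguage σ₁).Structure M]
    [(ordLanguage σ₁).Structure N] (f : M ↪[ordLanguage σ₁] N) (R : σ₁ 0) (x : Fin 0 → M)
    (y : Fin 0 → N) : ordRel R x ↔ ordRel R y := by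
  rw [← ordRel_map f, Subsingleton.elim (fun j => f (x j)) y]

/-- The empty substructure lies in the common age and carries the nullary relations. -/
theorem nullaryAgree_of_age_eq {I : Type v} {M : I → Type w}
    [∀ i, (ordLanguage σ₁).Structure (M i)]
    {K : Set (Bundled.{w} (ordLanguage σ₁).Structure)}
    (hK : ∀ i, (ordLanguage σ₁).age (M i) = K) : NullaryAgree σ₁ M := by
  intro R i j x y
  have hmem := relationalSubstructure_mem_age (L := ordLanguage σ₁) (M := M i) Set.finite_empty
  have hmem' := hmem
  rw [hK i, ← hK j] at hmem'
  obtain ⟨f⟩ := hmem.2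
  obtain ⟨g⟩ := hmem'.2
  exact (nullaryAgree_of_embedding f R (fun j => j.elim0) x).symm.trans
    (nullaryAgree_of_embedding g R _ y)

/-- A nonempty finite structure embedding in a semi-direct product is itself a semi-direct
product with nonempty fibers. -/
theorem exists_equiv_semidirectUnion {I : Type v} [(ordLanguage σ₂).Structure I] {M : I → Type w}
    [∀ i, (ordLanguage σ₁).Structure (M i)] (hM : NullaryAgree σ₁ M)
    {K : Set (Bundled.{w} (ordLanguage σ₁).Structure)}
    (hK : ∀ i, (ordLanguage σ₁).age (M i) = K)
    {A : Type*} [(semidirectLanguage σ₁ σ₂).Structure A] [Finite A] [Nonempty A]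
    (f : A ↪[semidirectLanguage σ₁ σ₂] SemidirectUnion I M) :
    ∃ (A₀ : ClassObj ((ordLanguage σ₂).age I)) (F : A₀.obj → ClassObj K),
      Nonempty A₀.obj ∧ (∀ i, Nonempty (F i).obj) ∧
        Nonempty (A ≃[semidirectLanguage σ₁ σ₂]
          SemidirectUnion A₀.obj fun i => (F i).obj) := by
  let s : Set I := Set.range fun x => (f x).1
  let t : ∀ i, Set (M i) := fun i => {m | (⟨i, m⟩ : SemidirectUnion I M) ∈ Set.range f}
  have ht : ∀ i, (t i).Finite := fun i =>
    (Set.finite_range f).preimage (sigma_mk_injective (i := i)).injOn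
  let A₀ : ClassObj ((ordLanguage σ₂).age I) :=
    ⟨_, relationalSubstructure_mem_age (s := s) (Set.finite_range _)⟩
  let F : A₀.obj → ClassObj K := fun i : s =>
    ⟨⟨relationalSubstructure (L := ordLanguage σ₁) (t i.1), inferInstance⟩, by
    rw [← hK i.1]
    exact relationalSubstructure_mem_age (ht i.1)⟩
  have hne : Nonempty A₀.obj := ⟨⟨_, Classical.arbitrary A, rfl⟩⟩
  refine ⟨A₀, F, hne, ?_, ?_⟩
  · rintro ⟨_, x, rfl⟩
    exact ⟨⟨(f x).2, x, rfl⟩⟩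
  · refine nonempty_equiv_of_range_eq f (SemidirectUnion.map hM
      (Substructure.subtype (relationalSubstructure s))
      fun i : s => Substructure.subtype (relationalSubstructure (t i.1))) ?_
    ext y
    constructor
    · rintro ⟨x, rfl⟩
      exact ⟨⟨⟨_, x, rfl⟩, ⟨(f x).2, x, rfl⟩⟩, rfl⟩
    · rintro ⟨⟨i, m⟩, rfl⟩
      exact m.2

end Age

/-! ### The Ramsey property of the semi-direct product -/

theorem theorem5 {σ₁ : ℕ → Type*} {σ₂ : ℕ → Type*}
    (I : Type*) [Countable I] [(ordLanguage σ₂).Structure I]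
    (hI : IsOrderedStructure σ₂ I)
    (M : I → Type*) [∀ i, Countable (M i)] [∀ i, (ordLanguage σ₁).Structure (M i)]
    (hM : ∀ i, IsOrderedStructure σ₁ (M i))
    (K : Set (CategoryTheory.Bundled (ordLanguage σ₁).Structure))
    (hK : ∀ i, (ordLanguage σ₁).age (M i) = K)
    (hIRP : HasRP (ordLanguage σ₂) I) (hKRP : RamseyProperty K) :
    HasRP (semidirectLanguage σ₁ σ₂) (SemidirectUnion I M) := by
  intro A hA B hB k hk
  by_cases hempty : IsEmpty A ∨ IsEmpty B
  · exact ⟨B, hB, exists_ramsey_of_isEmpty hempty⟩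
  rw [not_or, not_isEmpty_iff, not_isEmpty_iff] at hempty
  obtain ⟨_, _⟩ := hempty
  have hMnull := nullaryAgree_of_age_eq hK
  have := finite_of_mem_age hA
  have := finite_of_mem_age hB
  obtain ⟨f⟩ := hA.2
  obtain ⟨f'⟩ := hB.2
  -- Nonemptiness of `A` supplies an index, which realises `K` as the age of a structure.
  let i₀ : I := (f (Classical.arbitrary A)).1
  have hKmem : ∀ N ∈ K, N ∈ (ordLanguage σ₁).age (M i₀) := fun N hN => (hK i₀).symm ▸ hN
  have hKnull : NullaryAgree σ₁ fun N : ClassObj K => N.obj := fun R N N' x y =>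
    (nullaryAgree_of_embedding (hKmem _ N.mem).2.some R x Fin.elim0).trans
      (nullaryAgree_of_embedding (hKmem _ N'.mem).2.some R y Fin.elim0).symm
  have hKfin : ∀ N ∈ K, Finite N := fun N hN => finite_of_mem_age (hKmem N hN)
  have hIfin : ∀ N ∈ (ordLanguage σ₂).age I, Finite N := fun N hN => finite_of_mem_age hN
  have hIord : ∀ N ∈ (ordLanguage σ₂).age I, IsOrderedStructure σ₂ N := fun N hN =>
    hI.of_embedding hN.2.some
  obtain ⟨A₀, F, _, hF, ⟨e⟩⟩ := exists_equiv_semidirectUnion hMnull hK f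
  obtain ⟨B₀, G, _, -, ⟨e'⟩⟩ := exists_equiv_semidirectUnion hMnull hK f'
  have := hIfin _ A₀.mem
  have := hIfin _ B₀.mem
  obtain ⟨D, hD, hDemb⟩ := exists_joint_embedding_of_mem_age
    (fun p : A₀.obj ⊕ B₀.obj => (Sum.elim F G p).obj) fun p => hKmem _ (Sum.elim F G p).mem
  obtain ⟨k, rfl⟩ := Nat.exists_eq_add_of_le' hk
  obtain ⟨C₀, C, _, hC⟩ := exists_embeddingArrow (hIRP.morphismRamsey hIfin hIord) hIfin hIord
    (hKRP.morphismRamsey hKfin fun N hN => (hM i₀).of_embedding (hKmem N hN).2.some) hKfin hKnull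
    A₀ B₀ F G hF ⟨D, hK i₀ ▸ hD⟩ (fun i => (hDemb (Sum.inl i)).some)
    (fun i => (hDemb (Sum.inr i)).some) k
  have := hIfin _ C₀.mem
  have : ∀ i, Finite (C i).obj := fun i => hKfin _ (C i).mem
  have hfin : Finite (SemidirectUnion C₀.obj fun i => (C i).obj) :=
    inferInstanceAs (Finite (Σ i, (C i).obj))
  obtain ⟨h⟩ := C₀.mem.2
  -- Equality of the ages lets each fibre `C i` embed in whichever `M (h i)` lies over its image.
  refine ⟨CategoryTheory.Bundled.of (SemidirectUnion C₀.obj fun i => (C i).obj),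
    ⟨FirstOrder.Language.Structure.fg_iff_finite.2 hfin, ⟨SemidirectUnion.map hMnull h fun i =>
      ((hK (h i)).symm ▸ (C i).mem : (C i).obj ∈ (ordLanguage σ₁).age (M (h i))).2.some⟩⟩,
    (hC.of_equiv e e').exists_copy⟩
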